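/- Let $\mathscr H$ be a complex Hilbert space and, for $1<p<\infty$, let $\mathbb B_p(\mathscr H)$ be the Schatten $p$-class, i.e. the compact operators $T$ on $\mathscr H$ whose singular values $s_j(T)$ (the square roots of the eigenvalues of $T^*T$, counted with multiplicity) satisfy $\|T\|_p=\big(\sum_j s_j(T)^p\big)^{1/p}<\infty$. Let $q$ be the conjugate exponent of $p$, $\frac1p+\frac1q=1$. Let $Q=(q_{ij})$ be a real suborthogonal $s\times t$ matrix, that is, a real matrix with orthonormal columns, $Q^TQ=I_t$. Let $X_1,\dots,X_s,Y_1,\dots,Y_t\in\mathbb B_p(\mathscr H)$ satisfy $(X_1,\dots,X_s)^T=Q(Y_1,\dots,Y_t)^T$, that is, $X_i=\sum_{j=1}^t q_{ij}Y_j$ for $i=1,\dots,s$. If $1<p\le 2$, then $$\sum_{i=1}^s\|X_i\|_p^q\le\Big(\max_{i,j}|q_{ij}|\Big)^{\frac qp-1}\Big(\sum_{j=1}^t\|Y_j\|_p^p\Big)^{\frac qp}.$$ If $2\le p<\infty$, then the reverse inequality holds: $$\sum_{i=1}^s\|X_i\|_p^q\ge\Big(\max_{i,j}|q_{ij}|\Big)^{\frac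 qp-1}\Big(\sum_{j=1}^t\|Y_j\|_p^p\Big)^{\frac qp}.$$ -/

import Mathlib

noncomputable section SchattenClass

variable {H : Type*} [NormedAddCommGroup H] [InnerProductSpace ℂ H] [CompleteSpace H]

/-- The multiplicity of `σ > 0` as a singular value of `T`. The singular values of `T` are the
square roots of the eigenvalues of `T* T`, so this is the dimension of the eigenspace of `T* T` for
the eigenvalue `σ ^ 2` (it is finite when `T` is compact, and `0` if `σ` is no singular value). -/
def singularValueMultiplicity (T : H →L[ℂ] H) (σ : ℝ) : ℕ :=
  Module.finrank ℂ
    (Module.End.eigenspace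
      ((ContinuousLinearMap.adjoint T ∘L T : H →L[ℂ] H) : H →ₗ[ℂ] H) ((σ ^ 2 : ℝ) : ℂ))

/-- The sum `∑ⱼ sⱼ(T) ^ p` of the `p`-th powers of the (nonzero) singular values of the compact
operator `T`, each repeated according to its multiplicity, as an element of `[0, ∞]`. -/
def schattenSum (p : ℝ) (T : H →L[ℂ] H) : ENNReal :=
  ∑' σ : {σ : ℝ // 0 < σ},
    (singularValueMultiplicity T σ : ENNReal) * ENNReal.ofReal ((σ : ℝ) ^ p)

variable (H) in
/-- The Schatten `p`-class: the compact operators `T` on `H` with `∑ⱼ sⱼ(T) ^ p < ∞`. -/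
def schattenClass (p : ℝ) : Set (H →L[ℂ] H) :=
  {T | IsCompactOperator T ∧ schattenSum p T < ⊤}

/-- The Schatten `p`-norm `‖T‖_p = (∑ⱼ sⱼ(T) ^ p) ^ (1 / p)` of an operator in the Schatten
`p`-class. -/
def schattenNorm (p : ℝ) (T : H →L[ℂ] H) : ℝ :=
  (schattenSum p T).toReal ^ (1 / p)

end SchattenClass

/-- A real suborthogonal `s × t` matrix: its columns are orthonormal. -/
def IsSuborthogonal {s t : ℕ} (Q : Matrix (Fin s) (Fin t) ℝ) : Prop :=
  Q.transpose * Q = 1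

/-- The maximum of the moduli of the entries of a real matrix. -/
noncomputable def maxAbsEntry {s t : ℕ} (Q : Matrix (Fin s) (Fin t) ℝ) : ℝ :=
  ⨆ ij : Fin s × Fin t, |Q ij.1 ij.2|

/-!
Consider the bilinear form `(Z, Y) ↦ ∑ i, ∑ j, q i j * tr (Z i * Y j)`. It is bounded by
`max |q i j|` on trace-class `Y` against bounded `Z`, and by `1` on Hilbert–Schmidt operators, since
`Q` is a contraction. In the bases of singular vectors the three lines theorem interpolates between
these two bounds and gives, for `q ≥ 2`,
`|∑ i, ∑ j, q i j * tr (Z i * Y j)| ≤ m ^ (1 - 2 / q) * (∑ ‖Y j‖_p ^ p) ^ (1 / p) *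
(∑ ‖Z i‖_q ^ p) ^ (1 / p)`.
Choosing `Z i` extremal for the duality with `X i = ∑ q i j Y j` gives the inequality for `p ≤ 2`.
Choosing instead `Y j` extremal for the duality with `∑ i, q i j Z i`, and then `Z i = X i`, for
which orthonormality of the columns makes that sum the given `Y j`, gives the reverse inequality
with `p` and `q` interchanged.
-/

section Interpolation

open Complex Matrix

/-- The geometric interpolation `x₀ ^ (1 - w) * x₁ ^ w` between two positive reals, at a complex
parameter `w`; its modulus only depends on the real part of `w`. -/
noncomputable def geomInterp (x₀ x₁ : ℝ) (w : ℂ) : ℂ :=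
  (x₀ : ℂ) ^ (1 - w) * (x₁ : ℂ) ^ w

variable {x₀ x₁ : ℝ}

theorem norm_geomInterp (hx₀ : 0 < x₀) (hx₁ : 0 < x₁) (w : ℂ) :
    ‖geomInterp x₀ x₁ w‖ = x₀ ^ (1 - w.re) * x₁ ^ w.re := by
  simp only [geomInterp, norm_mul, norm_cpow_eq_rpow_re_of_pos hx₀,
    norm_cpow_eq_rpow_re_of_pos hx₁, sub_re, one_re]

theorem norm_geomInterp_of_re_eq_zero (hx₀ : 0 < x₀) (hx₁ : 0 < x₁) {w : ℂ} (hw : w.re = 0) :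
    ‖geomInterp x₀ x₁ w‖ = x₀ := by
  rw [norm_geomInterp hx₀ hx₁, hw, sub_zero, Real.rpow_one, Real.rpow_zero, mul_one]

theorem norm_geomInterp_of_re_eq_one (hx₀ : 0 < x₀) (hx₁ : 0 < x₁) {w : ℂ} (hw : w.re = 1) :
    ‖geomInterp x₀ x₁ w‖ = x₁ := by
  rw [norm_geomInterp hx₀ hx₁, hw, sub_self, Real.rpow_one, Real.rpow_zero, one_mul]

theorem norm_geomInterp_le_max (hx₀ : 0 < x₀) (hx₁ : 0 < x₁) {w : ℂ}
    (hw : w.re ∈ Set.Icc (0 : ℝ) 1) : ‖geomInterp x₀ x₁ w‖ ≤ max x₀ x₁ := by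
  have hmax : 0 < max x₀ x₁ := lt_max_of_lt_left hx₀
  calc ‖geomInterp x₀ x₁ w‖ = x₀ ^ (1 - w.re) * x₁ ^ w.re := norm_geomInterp hx₀ hx₁ w
    _ ≤ max x₀ x₁ ^ (1 - w.re) * max x₀ x₁ ^ w.re := by
        gcongr
        exacts [sub_nonneg.2 hw.2, le_max_left _ _, hw.1, le_max_right _ _]
    _ = max x₀ x₁ := by rw [← Real.rpow_add hmax, sub_add_cancel, Real.rpow_one]

theorem geomInterp_ofReal (hx₀ : 0 ≤ x₀) (hx₁ : 0 ≤ x₁) (t : ℝ) :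
    geomInterp x₀ x₁ t = ((x₀ ^ (1 - t) * x₁ ^ t : ℝ) : ℂ) := by
  simp only [geomInterp, ofReal_mul, ofReal_cpow hx₀, ofReal_cpow hx₁, ofReal_sub, ofReal_one]

theorem differentiable_geomInterp (hx₀ : x₀ ≠ 0) (hx₁ : x₁ ≠ 0) :
    Differentiable ℂ (geomInterp x₀ x₁) :=
  .mul (.const_cpow (by fun_prop) (.inl (ofReal_ne_zero.2 hx₀)))
    (.const_cpow (by fun_prop) (.inl (ofReal_ne_zero.2 hx₁)))

theorem norm_dotProduct_mulVec_le_interp {α β : Type*} [Fintype α] [Fintype β]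
    (M : Matrix β α ℂ) {z₀ z₁ : β → ℝ} {y₀ y₁ : α → ℝ}
    (hz₀ : ∀ b, 0 < z₀ b) (hz₁ : ∀ b, 0 < z₁ b) (hy₀ : ∀ a, 0 < y₀ a) (hy₁ : ∀ a, 0 < y₁ a)
    {C₀ C₁ : ℝ}
    (h₀ : ∀ (ζ : β → ℂ) (η : α → ℂ), (∀ b, ‖ζ b‖ = z₀ b) → (∀ a, ‖η a‖ = y₀ a) →
      ‖ζ ⬝ᵥ M *ᵥ η‖ ≤ C₀)
    (h₁ : ∀ (ζ : β → ℂ) (η : α → ℂ), (∀ b, ‖ζ b‖ = z₁ b) → (∀ a, ‖η a‖ = y₁ a) →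
      ‖ζ ⬝ᵥ M *ᵥ η‖ ≤ C₁)
    {θ : ℝ} (hθ : θ ∈ Set.Icc (0 : ℝ) 1) :
    ‖(fun b => ((z₀ b ^ (1 - θ) * z₁ b ^ θ : ℝ) : ℂ)) ⬝ᵥ
      M *ᵥ fun a => ((y₀ a ^ (1 - θ) * y₁ a ^ θ : ℝ) : ℂ)‖ ≤ C₀ ^ (1 - θ) * C₁ ^ θ := by
  let F (w : ℂ) : ℂ :=
    (fun b => geomInterp (z₀ b) (z₁ b) w) ⬝ᵥ M *ᵥ fun a => geomInterp (y₀ a) (y₁ a) w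
  have hF : Differentiable ℂ F :=
    .fun_sum fun b _ => (differentiable_geomInterp (hz₀ b).ne' (hz₁ b).ne').mul <|
      .fun_sum fun a _ => (differentiable_geomInterp (hy₀ a).ne' (hy₁ a).ne').const_mul _
  have hbdd : BddAbove ((norm ∘ F) '' HadamardThreeLines.verticalClosedStrip 0 1) := by
    refine ⟨∑ b, max (z₀ b) (z₁ b) * ∑ a, ‖M b a‖ * max (y₀ a) (y₁ a), ?_⟩
    rintro _ ⟨w, hw, rfl⟩
    refine (norm_sum_le _ _).trans (Finset.sum_le_sum fun b _ => ?_)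
    refine (norm_mul_le _ _).trans (mul_le_mul (norm_geomInterp_le_max (hz₀ b) (hz₁ b) hw) ?_
      (norm_nonneg _) (lt_max_of_lt_left (hz₀ b)).le)
    refine (norm_sum_le _ _).trans (Finset.sum_le_sum fun a _ => ?_)
    rw [norm_mul]
    gcongr
    exact norm_geomInterp_le_max (hy₀ a) (hy₁ a) hw
  have three_lines := HadamardThreeLines.norm_le_interp_of_mem_verticalClosedStrip₀₁' F
    (z := θ) (a := C₀) (b := C₁) hθ hF.diffContOnCl hbdd
    (fun w hw => h₀ _ _ (fun b => norm_geomInterp_of_re_eq_zero (hz₀ b) (hz₁ b) hw)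
      fun a => norm_geomInterp_of_re_eq_zero (hy₀ a) (hy₁ a) hw)
    (fun w hw => h₁ _ _ (fun b => norm_geomInterp_of_re_eq_one (hz₀ b) (hz₁ b) hw)
      fun a => norm_geomInterp_of_re_eq_one (hy₀ a) (hy₁ a) hw)
  simpa only [F, geomInterp_ofReal (hz₀ _).le (hz₁ _).le, geomInterp_ofReal (hy₀ _).le (hy₁ _).le,
    ofReal_re] using three_lines

end Interpolation

section MixedNorm

open Matrix

variable {ι α : Type*} {β : ι → Type*} [Fintype ι] [Fintype α] [∀ i, Fintype (β i)]
  {M : Matrix (Σ i, β i) α ℂ} {m : ℝ}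

theorem norm_dotProduct_mulVec_le_of_sum_norm_col_le (hM : ∀ a i, ∑ b, ‖M ⟨i, b⟩ a‖ ≤ m)
    {w : ι → ℝ} (hw : ∀ i, 0 ≤ w i) {ζ : (Σ i, β i) → ℂ} (hζ : ∀ b, ‖ζ b‖ = w b.1) (η : α → ℂ) :
    ‖ζ ⬝ᵥ M *ᵥ η‖ ≤ m * (∑ a, ‖η a‖) * ∑ i, w i := by
  calc ‖ζ ⬝ᵥ M *ᵥ η‖ ≤ ∑ b, ∑ a, w b.1 * (‖M b a‖ * ‖η a‖) := by
        refine (norm_sum_le _ _).trans (Finset.sum_le_sum fun b _ => ?_)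
        rw [norm_mul, hζ, ← Finset.mul_sum]
        refine mul_le_mul_of_nonneg_left ?_ (hw _)
        exact (norm_sum_le _ _).trans_eq (Finset.sum_congr rfl fun a _ => norm_mul _ _)
    _ = ∑ a, ∑ i, (∑ b, ‖M ⟨i, b⟩ a‖) * (‖η a‖ * w i) := by
        rw [Finset.sum_comm]
        simp only [Fintype.sum_sigma, Finset.sum_mul]
        exact Finset.sum_congr rfl fun a _ => Finset.sum_congr rfl fun i _ =>
          Finset.sum_congr rfl fun b _ => by ring
    _ ≤ ∑ a, ∑ i, m * (‖η a‖ * w i) := by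
        gcongr with a _ i _
        exacts [mul_nonneg (norm_nonneg _) (hw i), hM a i]
    _ = m * (∑ a, ‖η a‖) * ∑ i, w i := by
        rw [mul_assoc, Finset.sum_mul_sum]
        simp only [Finset.mul_sum]

theorem rpow_mul_sqrt_rpow {p q x : ℝ} (hpq : p.HolderConjugate q) (hq : 2 ≤ q) (hx : 0 ≤ x) :
    x ^ (1 - 2 / q) * √x ^ (2 / q) = x ^ (1 / p) := by
  have hexp : 1 - 2 / q + 1 / 2 * (2 / q) = 1 / p := by
    linear_combination -hpq.one_div_add_one_div
  rw [Real.sqrt_eq_rpow, ← Real.rpow_mul hx, ← hexp, Real.rpow_add_of_nonneg hx]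
  · exact sub_nonneg.2 ((div_le_one (by positivity)).2 hq)
  · positivity

theorem interp_rpow_eq_self {p q x : ℝ} (hpq : p.HolderConjugate q) (hx : 0 < x) :
    (x ^ p) ^ (1 - 2 / q) * (x ^ (p / 2)) ^ (2 / q) = x := by
  have hq := hpq.symm.ne_zero
  have hexp : p * (1 - 2 / q) + p / 2 * (2 / q) = 1 := by
    field_simp
    linarith [hpq.mul_eq_add]
  rw [← Real.rpow_mul hx.le, ← Real.rpow_mul hx.le, ← Real.rpow_add hx, hexp, Real.rpow_one]

theorem interp_rpow_mul_eq_self {p q x g : ℝ} (hpq : p.HolderConjugate q) (hx : 0 < x)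
    (hg : 0 < g) :
    (g ^ (p / q)) ^ (1 - 2 / q) * (x ^ (q / 2) * g ^ ((p - q) / (2 * q))) ^ (2 / q) = x := by
  have hq := hpq.symm.ne_zero
  have hexp : p / q * (1 - 2 / q) + (p - q) / (2 * q) * (2 / q) = 0 := by
    field_simp
    linarith [hpq.mul_eq_add]
  rw [Real.mul_rpow (by positivity) (by positivity), mul_left_comm, ← Real.rpow_mul hg.le,
    ← Real.rpow_mul hg.le, ← Real.rpow_add hg, hexp, Real.rpow_zero, mul_one, ← Real.rpow_mul hx.le,
    div_mul_div_cancel₀ two_ne_zero, div_self hq, Real.rpow_one]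

theorem rpow_sub_one_mul_self {g c : ℝ} (hg : 0 ≤ g) (hc : c ≠ 0) : g ^ (c - 1) * g = g ^ c := by
  rcases hg.eq_or_lt with rfl | hg
  · rw [mul_zero, Real.zero_rpow hc]
  · rw [← Real.rpow_add_one hg.ne', sub_add_cancel]

theorem sum_sq_rpow_mul_rpow_sum {γ : Type*} [Fintype γ] {p q : ℝ} (hp : 0 < p) (hq : 0 < q)
    {z : γ → ℝ} (hz : ∀ b, 0 ≤ z b) :
    ∑ b, (z b ^ (q / 2) * (∑ c, z c ^ q) ^ ((p - q) / (2 * q))) ^ 2 =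
      (∑ b, z b ^ q) ^ (p / q) := by
  set G := ∑ b, z b ^ q
  have hG : 0 ≤ G := Finset.sum_nonneg fun b _ => Real.rpow_nonneg (hz b) _
  have hexp : (p - q) / (2 * q) * (2 : ℕ) = p / q - 1 := by
    push_cast
    field_simp
  have hterm (b : γ) :
      (z b ^ (q / 2) * G ^ ((p - q) / (2 * q))) ^ 2 = G ^ (p / q - 1) * z b ^ q := by
    rw [mul_pow, ← Real.rpow_mul_natCast (hz b), ← Real.rpow_mul_natCast hG, hexp, Nat.cast_two,
      div_mul_cancel₀ _ two_ne_zero, mul_comm]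
  simp only [hterm, ← Finset.mul_sum]
  exact rpow_sub_one_mul_self hG (div_pos hp hq).ne'

/-- Riesz–Thorin interpolation between the exponents `(p, q) = (1, ∞)` and `(p, q) = (2, 2)`. -/
theorem norm_dotProduct_mulVec_le_mixedNorm (hm : 0 ≤ m) (hM₁ : ∀ a i, ∑ b, ‖M ⟨i, b⟩ a‖ ≤ m)
    (hM₂ : ∀ ζ η, ‖ζ ⬝ᵥ M *ᵥ η‖ ≤ √(∑ b, ‖ζ b‖ ^ 2) * √(∑ a, ‖η a‖ ^ 2))
    {p q : ℝ} (hpq : p.HolderConjugate q) (hq : 2 ≤ q)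
    {z : (Σ i, β i) → ℝ} {y : α → ℝ} (hz : ∀ b, 0 < z b) (hy : ∀ a, 0 < y a) :
    ‖(fun b => (z b : ℂ)) ⬝ᵥ M *ᵥ fun a => (y a : ℂ)‖ ≤
      m ^ (1 - 2 / q) * (∑ a, y a ^ p) ^ (1 / p) *
        (∑ i, (∑ b, z ⟨i, b⟩ ^ q) ^ (p / q)) ^ (1 / p) := by
  set G : ι → ℝ := fun i => ∑ b, z ⟨i, b⟩ ^ q
  set P : ℝ := ∑ a, y a ^ p
  set R : ℝ := ∑ i, G i ^ (p / q)
  have hG₀ (i) : 0 ≤ G i := Finset.sum_nonneg fun b _ => Real.rpow_nonneg (hz _).le _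
  have hG (b : Σ i, β i) : 0 < G b.1 :=
    Finset.sum_pos (fun b _ => Real.rpow_pos_of_pos (hz _) _) ⟨b.2, Finset.mem_univ _⟩
  have hP : 0 ≤ P := Finset.sum_nonneg fun a _ => Real.rpow_nonneg (hy a).le _
  have hR : 0 ≤ R := Finset.sum_nonneg fun i _ => Real.rpow_nonneg (hG₀ i) _
  have endpoint₁ (ζ : (Σ i, β i) → ℂ) (η : α → ℂ) (hζ : ∀ b, ‖ζ b‖ = G b.1 ^ (p / q))
      (hη : ∀ a, ‖η a‖ = y a ^ p) : ‖ζ ⬝ᵥ M *ᵥ η‖ ≤ m * P * R := by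
    simpa only [hη] using norm_dotProduct_mulVec_le_of_sum_norm_col_le hM₁
      (fun i => Real.rpow_nonneg (hG₀ i) _) hζ η
  have endpoint₂ (ζ : (Σ i, β i) → ℂ) (η : α → ℂ)
      (hζ : ∀ b, ‖ζ b‖ = z b ^ (q / 2) * G b.1 ^ ((p - q) / (2 * q)))
      (hη : ∀ a, ‖η a‖ = y a ^ (p / 2)) : ‖ζ ⬝ᵥ M *ᵥ η‖ ≤ √R * √P := by
    have hη₂ (a : α) : ‖η a‖ ^ 2 = y a ^ p := by
      rw [hη, ← Real.rpow_mul_natCast (hy a).le, Nat.cast_two, div_mul_cancel₀ _ two_ne_zero]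
    refine (hM₂ ζ η).trans_eq ?_
    simp only [hζ, hη₂, Fintype.sum_sigma, G, R, P,
      sum_sq_rpow_mul_rpow_sum hpq.pos hpq.symm.pos fun b => (hz ⟨_, b⟩).le]
  have interp := norm_dotProduct_mulVec_le_interp M (fun b => Real.rpow_pos_of_pos (hG b) _)
    (fun b => mul_pos (Real.rpow_pos_of_pos (hz b) _) (Real.rpow_pos_of_pos (hG b) _))
    (fun a => Real.rpow_pos_of_pos (hy a) _) (fun a => Real.rpow_pos_of_pos (hy a) _)
    endpoint₁ endpoint₂ (θ := 2 / q) ⟨by positivity, (div_le_one hpq.symm.pos).2 hq⟩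
  simp only [interp_rpow_eq_self hpq (hy _), interp_rpow_mul_eq_self hpq (hz _) (hG _)] at interp
  rw [Real.mul_rpow (mul_nonneg hm hP) hR, Real.mul_rpow hm hP,
    Real.mul_rpow (Real.sqrt_nonneg _) (Real.sqrt_nonneg _)] at interp
  rw [← rpow_mul_sqrt_rpow hpq hq hP, ← rpow_mul_sqrt_rpow hpq hq hR]
  linarith

end MixedNorm

section Contraction

open Matrix
open scoped InnerProductSpace ComplexOrder MatrixOrder

variable {𝕜 E ι κ : Type*} [RCLike 𝕜] [NormedAddCommGroup E] [InnerProductSpace 𝕜 E]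

theorem sum_inner_sum_smul [Fintype ι] [Fintype κ] (A : Matrix ι κ 𝕜) (y : κ → E) :
    ∑ i, ⟪∑ j, A i j • y j, ∑ j, A i j • y j⟫_𝕜 = ∑ j, ∑ k, (Aᴴ * A) j k * ⟪y j, y k⟫_𝕜 := by
  simp only [sum_inner, inner_sum, inner_smul_left, inner_smul_right, mul_apply,
    conjTranspose_apply, starRingEnd_apply, Finset.sum_mul, Finset.mul_sum, mul_assoc]
  rw [Finset.sum_comm_cycle]
  refine Finset.sum_congr rfl fun j _ => Finset.sum_comm.trans ?_
  exact Finset.sum_congr rfl fun k _ => Finset.sum_congr rfl fun i _ => mul_left_comm _ _ _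

theorem sum_norm_sq_sum_smul_le [Fintype ι] [Fintype κ] [DecidableEq κ] {Q : Matrix ι κ 𝕜}
    (hQ : Qᴴ * Q ≤ 1) (y : κ → E) : ∑ i, ‖∑ j, Q i j • y j‖ ^ 2 ≤ ∑ j, ‖y j‖ ^ 2 := by
  obtain ⟨R, hR⟩ := CStarAlgebra.nonneg_iff_eq_star_mul_self.1 (sub_nonneg.2 hQ)
  have pythagoras : ∑ i, ⟪∑ j, Q i j • y j, ∑ j, Q i j • y j⟫_𝕜 +
      ∑ k, ⟪∑ j, R k j • y j, ∑ j, R k j • y j⟫_𝕜 = ∑ j, ⟪y j, y j⟫_𝕜 := by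
    have hsum : Qᴴ * Q + Rᴴ * R = 1 := by rw [← star_eq_conjTranspose R, ← hR, add_sub_cancel]
    simp only [sum_inner_sum_smul, ← Finset.sum_add_distrib, ← add_mul, ← Matrix.add_apply, hsum,
      one_apply, ite_mul, one_mul, zero_mul, Finset.sum_ite_eq, Finset.mem_univ, if_true]
  have norm_pythagoras : ∑ i, ‖∑ j, Q i j • y j‖ ^ 2 + ∑ k, ‖∑ j, R k j • y j‖ ^ 2 =
      ∑ j, ‖y j‖ ^ 2 := by
    simpa only [map_add, map_sum, inner_self_eq_norm_sq] using congrArg RCLike.re pythagoras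
  exact norm_pythagoras ▸ le_add_of_nonneg_right (Finset.sum_nonneg fun k _ => sq_nonneg _)

theorem norm_sq_sum_smul_of_orthonormal [Fintype ι] {x : ι → E} (hx : Orthonormal 𝕜 x)
    (c : ι → 𝕜) : ‖∑ a, c a • x a‖ ^ 2 = ∑ a, ‖c a‖ ^ 2 := by
  rw [← inner_self_eq_norm_sq (𝕜 := 𝕜), hx.inner_sum, map_sum]
  exact Finset.sum_congr rfl fun a _ => by rw [RCLike.conj_mul]; norm_cast

end Contraction

section Pairing

open Matrix
open scoped InnerProductSpace ComplexOrder MatrixOrder TensorProduct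

variable {H ι κ : Type*} [NormedAddCommGroup H] [InnerProductSpace ℂ H]
  {α : κ → Type*} {β : ι → Type*} {Q : Matrix ι κ ℂ} {m : ℝ}
  {e f : ∀ i, β i → H} {u v : ∀ j, α j → H}

/-- The matrix of `(Z, Y) ↦ ∑ i, ∑ j, Q i j * tr (Z i * Y j)` on operators
`Y j = ∑ a, y j a • |u j a⟩⟨v j a|` and `Z i = ∑ b, z i b • |f i b⟩⟨e i b|`, in the coefficients
`z` and `y`. -/
noncomputable def pairingMatrix (Q : Matrix ι κ ℂ) (e f : ∀ i, β i → H) (u v : ∀ j, α j → H) :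
    Matrix (Σ i, β i) (Σ j, α j) ℂ :=
  fun b a => Q b.1 a.1 * (⟪e b.1 b.2, u a.1 a.2⟫_ℂ * ⟪v a.1 a.2, f b.1 b.2⟫_ℂ)

theorem sum_norm_pairingMatrix_col_le [∀ i, Fintype (β i)] (hm : ∀ i j, ‖Q i j‖ ≤ m)
    (he : ∀ i, Orthonormal ℂ (e i)) (hf : ∀ i, Orthonormal ℂ (f i))
    (hu : ∀ j a, ‖u j a‖ = 1) (hv : ∀ j a, ‖v j a‖ = 1) (a : Σ j, α j) (i : ι) :
    ∑ b, ‖pairingMatrix Q e f u v ⟨i, b⟩ a‖ ≤ m := by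
  have bessel {x : β i → H} (hx : Orthonormal ℂ x) {w : H} (hw : ‖w‖ = 1) :
      √(∑ b, ‖⟪x b, w⟫_ℂ‖ ^ 2) ≤ 1 := by
    simpa [Real.sqrt_le_one, hw] using hx.sum_inner_products_le w (s := Finset.univ)
  calc ∑ b, ‖pairingMatrix Q e f u v ⟨i, b⟩ a‖
      = ‖Q i a.1‖ * ∑ b, ‖⟪e i b, u a.1 a.2⟫_ℂ‖ * ‖⟪f i b, v a.1 a.2⟫_ℂ‖ := by
        simp only [pairingMatrix, norm_mul, Finset.mul_sum, norm_inner_symm (v a.1 a.2)]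
    _ ≤ ‖Q i a.1‖ * 1 := by
        gcongr
        exact (Real.sum_mul_le_sqrt_mul_sqrt _ _ _).trans <|
          mul_le_one₀ (bessel (he i) (hu _ _)) (Real.sqrt_nonneg _) (bessel (hf i) (hv _ _))
    _ ≤ m := (mul_one _).trans_le (hm i a.1)

theorem exists_inner_swap (H : Type*) [NormedAddCommGroup H] [InnerProductSpace ℂ H]
    [CompleteSpace H] : ∃ C : H → H, ∀ x y : H, ⟪C x, C y⟫_ℂ = ⟪y, x⟫_ℂ := by
  obtain ⟨w, b, -⟩ := exists_hilbertBasis ℂ H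
  refine ⟨fun x => b.repr.symm (star (b.repr x)), fun x y => ?_⟩
  rw [LinearIsometryEquiv.inner_map_map, ← b.repr.inner_map_map y x, lp.inner_eq_tsum,
    lp.inner_eq_tsum]
  simp [mul_comm]

theorem orthonormal_tmul_comp {γ : Type*} {C : H → H} (hC : ∀ x y, ⟪C x, C y⟫_ℂ = ⟪y, x⟫_ℂ)
    {x y : γ → H} (hx : Orthonormal ℂ x) (hy : Orthonormal ℂ y) :
    Orthonormal ℂ fun c => x c ⊗ₜ[ℂ] C (y c) := by
  classical
  have hCy : Orthonormal ℂ fun c => C (y c) := by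
    rw [orthonormal_iff_ite] at hy ⊢
    exact fun c d => (hC _ _).trans ((hy d c).trans (by simp only [eq_comm]))
  exact (hx.tmul hCy).comp (fun c => (c, c)) fun _ _ h => (Prod.mk.inj h).1

variable [Fintype ι] [Fintype κ] [∀ i, Fintype (β i)] [∀ j, Fintype (α j)]

theorem dotProduct_pairingMatrix_mulVec (ζ : (Σ i, β i) → ℂ) (η : (Σ j, α j) → ℂ) :
    ζ ⬝ᵥ pairingMatrix Q e f u v *ᵥ η =
      ∑ b, ζ b * ∑ j, Q b.1 j *
        ∑ a, η ⟨j, a⟩ * (⟪e b.1 b.2, u j a⟫_ℂ * ⟪v j a, f b.1 b.2⟫_ℂ) := by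
  simp only [dotProduct, mulVec, pairingMatrix, Fintype.sum_sigma (α := α), Finset.mul_sum]
  exact Finset.sum_congr rfl fun b _ => Finset.sum_congr rfl fun j _ =>
    Finset.sum_congr rfl fun a _ => by ring

theorem dotProduct_pairingMatrix_mulVec' (ζ : (Σ i, β i) → ℂ) (η : (Σ j, α j) → ℂ) :
    ζ ⬝ᵥ pairingMatrix Q e f u v *ᵥ η =
      ∑ a, η a * ∑ i, Q i a.1 *
        ∑ b, ζ ⟨i, b⟩ * (⟪v a.1 a.2, f i b⟫_ℂ * ⟪e i b, u a.1 a.2⟫_ℂ) := by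
  simp only [dotProduct, mulVec, pairingMatrix, Finset.mul_sum]
  rw [Finset.sum_comm]
  simp only [Fintype.sum_sigma (α := β)]
  exact Finset.sum_congr rfl fun a _ => Finset.sum_congr rfl fun i _ =>
    Finset.sum_congr rfl fun b _ => by ring

variable [DecidableEq κ]

theorem norm_sum_inner_sum_le (hQ : Qᴴ * Q ≤ 1) (Z : ι → H) (Y : κ → H) :
    ‖∑ i, ⟪Z i, ∑ j, Q i j • Y j⟫_ℂ‖ ≤ √(∑ i, ‖Z i‖ ^ 2) * √(∑ j, ‖Y j‖ ^ 2) := by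
  calc ‖∑ i, ⟪Z i, ∑ j, Q i j • Y j⟫_ℂ‖ ≤ ∑ i, ‖Z i‖ * ‖∑ j, Q i j • Y j‖ :=
        (norm_sum_le _ _).trans (Finset.sum_le_sum fun i _ => norm_inner_le_norm _ _)
    _ ≤ √(∑ i, ‖Z i‖ ^ 2) * √(∑ i, ‖∑ j, Q i j • Y j‖ ^ 2) := Real.sum_mul_le_sqrt_mul_sqrt _ _ _
    _ ≤ √(∑ i, ‖Z i‖ ^ 2) * √(∑ j, ‖Y j‖ ^ 2) := by
        gcongr √_ * √?_
        exact sum_norm_sq_sum_smul_le hQ Y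

theorem norm_dotProduct_gram_mulVec_le (hQ : Qᴴ * Q ≤ 1) (he : ∀ i, Orthonormal ℂ (e i))
    (hu : ∀ j, Orthonormal ℂ (u j)) (ζ : (Σ i, β i) → ℂ) (η : (Σ j, α j) → ℂ) :
    ‖ζ ⬝ᵥ (of fun b a => Q b.1 a.1 * ⟪e b.1 b.2, u a.1 a.2⟫_ℂ) *ᵥ η‖ ≤
      √(∑ b, ‖ζ b‖ ^ 2) * √(∑ a, ‖η a‖ ^ 2) := by
  let Z (i : ι) : H := ∑ b, star (ζ ⟨i, b⟩) • e i b
  let Y (j : κ) : H := ∑ a, η ⟨j, a⟩ • u j a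
  have hZ : ∑ i, ‖Z i‖ ^ 2 = ∑ b, ‖ζ b‖ ^ 2 := by
    simp only [Z, Fintype.sum_sigma, norm_star, norm_sq_sum_smul_of_orthonormal (he _)]
  have hY : ∑ j, ‖Y j‖ ^ 2 = ∑ a, ‖η a‖ ^ 2 := by
    simp only [Y, Fintype.sum_sigma, norm_sq_sum_smul_of_orthonormal (hu _)]
  have gram_eq_inner : ζ ⬝ᵥ (of fun b a => Q b.1 a.1 * ⟪e b.1 b.2, u a.1 a.2⟫_ℂ) *ᵥ η =
      ∑ i, ⟪Z i, ∑ j, Q i j • Y j⟫_ℂ := by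
    simp only [Z, Y, dotProduct, mulVec, of_apply, Fintype.sum_sigma, sum_inner,
      inner_smul_left, starRingEnd_apply, star_star, inner_sum, inner_smul_right, Finset.mul_sum]
    refine Finset.sum_congr rfl fun i _ => Finset.sum_comm.trans ?_
    refine Finset.sum_congr rfl fun j _ => Finset.sum_comm.trans ?_
    exact Finset.sum_congr rfl fun a _ => Finset.sum_congr rfl fun b _ => by ring
  rw [gram_eq_inner, ← hZ, ← hY]
  exact norm_sum_inner_sum_le hQ Z Y

theorem norm_dotProduct_pairingMatrix_mulVec_le [CompleteSpace H] (hQ : Qᴴ * Q ≤ 1)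
    (he : ∀ i, Orthonormal ℂ (e i)) (hf : ∀ i, Orthonormal ℂ (f i))
    (hu : ∀ j, Orthonormal ℂ (u j)) (hv : ∀ j, Orthonormal ℂ (v j))
    (ζ : (Σ i, β i) → ℂ) (η : (Σ j, α j) → ℂ) :
    ‖ζ ⬝ᵥ pairingMatrix Q e f u v *ᵥ η‖ ≤ √(∑ b, ‖ζ b‖ ^ 2) * √(∑ a, ‖η a‖ ^ 2) := by
  obtain ⟨C, hC⟩ := exists_inner_swap H
  -- `|u⟩⟨v| ↦ u ⊗ C v` identifies the Hilbert–Schmidt operators with vectors of `H ⊗ H`.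
  have pairingMatrix_eq_gram : pairingMatrix Q e f u v = of fun b a =>
      Q b.1 a.1 * ⟪e b.1 b.2 ⊗ₜ[ℂ] C (f b.1 b.2), u a.1 a.2 ⊗ₜ[ℂ] C (v a.1 a.2)⟫_ℂ := by
    ext b a
    rw [of_apply, TensorProduct.inner_tmul, hC, pairingMatrix]
  rw [pairingMatrix_eq_gram]
  exact norm_dotProduct_gram_mulVec_le hQ (fun i => orthonormal_tmul_comp hC (he i) (hf i))
    (fun j => orthonormal_tmul_comp hC (hu j) (hv j)) ζ η

theorem norm_dotProduct_pairingMatrix_mulVec_le_mixedNorm [CompleteSpace H]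
    (hQ : Qᴴ * Q ≤ 1) (hm : 0 ≤ m) (hQm : ∀ i j, ‖Q i j‖ ≤ m)
    (he : ∀ i, Orthonormal ℂ (e i)) (hf : ∀ i, Orthonormal ℂ (f i))
    (hu : ∀ j, Orthonormal ℂ (u j)) (hv : ∀ j, Orthonormal ℂ (v j))
    {p q : ℝ} (hpq : p.HolderConjugate q) (hq : 2 ≤ q)
    {z : (Σ i, β i) → ℝ} {y : (Σ j, α j) → ℝ} (hz : ∀ b, 0 < z b) (hy : ∀ a, 0 < y a) :
    ‖(fun b => (z b : ℂ)) ⬝ᵥ pairingMatrix Q e f u v *ᵥ fun a => (y a : ℂ)‖ ≤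
      m ^ (1 - 2 / q) * (∑ a, y a ^ p) ^ (1 / p) *
        (∑ i, (∑ b, z ⟨i, b⟩ ^ q) ^ (p / q)) ^ (1 / p) :=
  norm_dotProduct_mulVec_le_mixedNorm hm
    (sum_norm_pairingMatrix_col_le hQm he hf (fun j => (hu j).1) fun j => (hv j).1)
    (norm_dotProduct_pairingMatrix_mulVec_le hQ he hf hu hv) hpq hq hz hy

end Pairing

section SingularValueDecomposition

open ContinuousLinearMap Module.End
open scoped InnerProductSpace

variable {H F : Type*} [NormedAddCommGroup H] [InnerProductSpace ℂ H] [CompleteSpace H]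
  [NormedAddCommGroup F] [InnerProductSpace ℂ F]

section RectangularOperator

variable {T : H →L[ℂ] F} {γ : Type*} {f : γ → H}

theorem hasSum_inner_apply_mul_inner (hf : Orthonormal ℂ f)
    (hker : ∀ x, (∀ k, ⟪f k, x⟫_ℂ = 0) → T x = 0) (x : F) (y : H) :
    HasSum (fun k => ⟪x, T (f k)⟫_ℂ * ⟪f k, y⟫_ℂ) ⟪x, T y⟫_ℂ := by
  obtain ⟨w, b, hw, hb⟩ := hf.toSubtypeRange.exists_hilbertBasis_extension
  let g (k : γ) : w := ⟨f k, hw ⟨k, rfl⟩⟩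
  have hg : Function.Injective g := fun k l h =>
    hf.linearIndependent.injective (congrArg Subtype.val h)
  have expansion : HasSum (fun c : w => ⟪x, T c⟫_ℂ * ⟪(c : H), y⟫_ℂ) ⟪x, T y⟫_ℂ := by
    refine (((innerSL ℂ x).comp T).hasSum (b.hasSum_repr y)).congr_fun fun c => ?_
    rw [map_smul, b.repr_apply_apply, hb, smul_eq_mul, mul_comm]
    rfl
  refine (hg.hasSum_iff fun c hc => ?_).2 expansion
  have hTc : T c = 0 := hker _ fun k => by
    have hne : g k ≠ c := fun h => hc ⟨k, h⟩
    simpa only [hb, g] using b.orthonormal.2 hne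
  rw [hTc, inner_zero_right, zero_mul]

variable [CompleteSpace F]

theorem exists_pos_sq_eq_of_eigenvector {w : H} (hw : w ≠ 0) {μ : ℂ} (hμ : μ ≠ 0)
    (h : adjoint T (T w) = μ • w) : ∃ σ : ℝ, 0 < σ ∧ ((σ ^ 2 : ℝ) : ℂ) = μ := by
  have hTw : T w ≠ 0 := fun h₀ => smul_ne_zero hμ hw (by rw [← h, h₀, map_zero])
  have hw' : (‖w‖ : ℂ) ≠ 0 := by exact_mod_cast norm_ne_zero_iff.2 hw
  have rayleigh : μ * (‖w‖ : ℂ) ^ 2 = (‖T w‖ : ℂ) ^ 2 := by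
    have := adjoint_inner_right T w (T w)
    rwa [h, inner_smul_right, inner_self_eq_norm_sq_to_K, inner_self_eq_norm_sq_to_K] at this
  refine ⟨‖T w‖ / ‖w‖, div_pos (norm_pos_iff.2 hTw) (norm_pos_iff.2 hw), ?_⟩
  push_cast
  rw [div_pow, ← rayleigh, mul_div_cancel_right₀ _ (pow_ne_zero 2 hw')]

theorem apply_eq_zero_of_forall_inner_eigenspace_eq_zero (hT : IsCompactOperator T) {x : H}
    (hx : ∀ σ : ℝ, 0 < σ → ∀ w, adjoint T (T w) = ((σ ^ 2 : ℝ) : ℂ) • w → ⟪w, x⟫_ℂ = 0) :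
    T x = 0 := by
  set A : H →L[ℂ] H := adjoint T ∘L T
  have hAc : IsCompactOperator A := hT.clm_comp (adjoint T)
  have hAs : (A : H →ₗ[ℂ] H).IsSymmetric := (isPositive_adjoint_comp_self T).isSymmetric
  have hAx : A x ∈ (⨆ μ, eigenspace (A : H →ₗ[ℂ] H) μ)ᗮ := by
    rw [← Submodule.iInf_orthogonal, Submodule.mem_iInf]
    intro μ w hw
    have hAw : adjoint T (T w) = μ • w := mem_eigenspace_iff.1 hw
    have hwAx : ⟪w, A x⟫_ℂ = starRingEnd ℂ μ * ⟪w, x⟫_ℂ := by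
      rw [← inner_smul_left, ← hAw]
      exact (hAs w x).symm
    rw [hwAx]
    rcases eq_or_ne w 0 with rfl | hw₀
    · rw [inner_zero_left, mul_zero]
    rcases eq_or_ne μ 0 with rfl | hμ
    · rw [map_zero, zero_mul]
    obtain ⟨σ, hσ, rfl⟩ := exists_pos_sq_eq_of_eigenvector hw₀ hμ hAw
    rw [hx σ hσ w hAw, mul_zero]
  rw [orthogonalComplement_iSup_eigenspaces_eq_bot hAc hAs] at hAx
  have hker : x ∈ A.ker := hAx
  rwa [ker_adjoint_comp_self] at hker

theorem orthonormal_inv_smul_apply {σ : γ → ℝ} (hf : Orthonormal ℂ f)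
    (hσ : ∀ k, σ k ≠ 0) (hTf : ∀ k, adjoint T (T (f k)) = ((σ k ^ 2 : ℝ) : ℂ) • f k) :
    Orthonormal ℂ fun k => (σ k : ℂ)⁻¹ • T (f k) := by
  classical
  rw [orthonormal_iff_ite] at hf ⊢
  intro k l
  have hσ' : (σ k : ℂ) ≠ 0 := Complex.ofReal_ne_zero.2 (hσ k)
  rw [inner_smul_left, inner_smul_right, ← adjoint_inner_right, hTf, inner_smul_right, hf,
    map_inv₀, Complex.conj_ofReal, Complex.ofReal_pow]
  split_ifs with h
  · subst h
    field_simp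
  · simp only [mul_zero]

end RectangularOperator

variable {T : H →L[ℂ] H} {p : ℝ}

/-- The index set of the nonzero singular values of `T`, each repeated according to its
multiplicity; `k.1` is the singular value with index `k`. -/
abbrev SingularIndex (T : H →L[ℂ] H) : Type :=
  Σ σ : {σ : ℝ // 0 < σ}, Fin (singularValueMultiplicity T σ)

theorem schattenSum_eq_tsum_singularIndex (p : ℝ) (T : H →L[ℂ] H) :
    schattenSum p T = ∑' k : SingularIndex T, ENNReal.ofReal ((k.1 : ℝ) ^ p) := by
  rw [schattenSum, ENNReal.tsum_sigma']
  simp only [tsum_fintype, Finset.sum_const, Finset.card_univ, Fintype.card_fin, nsmul_eq_mul]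

theorem schattenNorm_nonneg (p : ℝ) (T : H →L[ℂ] H) : 0 ≤ schattenNorm p T :=
  Real.rpow_nonneg ENNReal.toReal_nonneg _

theorem hasSum_schattenNorm (hp : 0 < p) (hT : T ∈ schattenClass H p) :
    HasSum (fun k : SingularIndex T => (k.1 : ℝ) ^ p) (schattenNorm p T ^ p) := by
  have hsum : ∑' k : SingularIndex T, ENNReal.ofReal ((k.1 : ℝ) ^ p) ≠ ⊤ := by
    rw [← schattenSum_eq_tsum_singularIndex]
    exact hT.2.ne
  rw [schattenNorm, ← Real.rpow_mul ENNReal.toReal_nonneg, one_div_mul_cancel hp.ne',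
    Real.rpow_one, schattenSum_eq_tsum_singularIndex,
    ENNReal.tsum_toReal_eq fun _ => ENNReal.ofReal_ne_top]
  refine (ENNReal.summable_toReal hsum).hasSum.congr_fun fun k => ?_
  exact (ENNReal.toReal_ofReal (Real.rpow_nonneg k.1.2.le _)).symm

theorem exists_rightSingularVectors (hT : IsCompactOperator T) :
    ∃ f : SingularIndex T → H, Orthonormal ℂ f ∧
      (∀ k, adjoint T (T (f k)) = (((k.1 : ℝ) ^ 2 : ℝ) : ℂ) • f k) ∧
      ∀ x, (∀ k, ⟪f k, x⟫_ℂ = 0) → T x = 0 := by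
  let A : H →L[ℂ] H := adjoint T ∘L T
  let E (σ : {σ : ℝ // 0 < σ}) : Submodule ℂ H :=
    eigenspace (A : H →ₗ[ℂ] H) (((σ : ℝ) ^ 2 : ℝ) : ℂ)
  have (σ : {σ : ℝ // 0 < σ}) : FiniteDimensional ℂ (E σ) :=
    finite_dimensional_eigenspace (hT.clm_comp (adjoint T)) _
      (by exact_mod_cast (pow_pos σ.2 2).ne')
  let b (σ : {σ : ℝ // 0 < σ}) :
      OrthonormalBasis (Fin (singularValueMultiplicity T σ)) ℂ (E σ) :=
    stdOrthonormalBasis ℂ (E σ)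
  have hE : OrthogonalFamily ℂ (fun σ => E σ) fun σ => (E σ).subtypeₗᵢ :=
    (isPositive_adjoint_comp_self T).isSymmetric.orthogonalFamily_eigenspaces.comp
      (f := fun σ : {σ : ℝ // 0 < σ} => (((σ : ℝ) ^ 2 : ℝ) : ℂ)) fun σ τ h =>
        Subtype.ext ((pow_left_inj₀ σ.2.le τ.2.le two_ne_zero).1 (Complex.ofReal_injective h))
  refine ⟨fun k => b k.1 k.2, hE.orthonormal_sigma_orthonormal fun σ => (b σ).orthonormal,
    fun k => mem_eigenspace_iff.1 (b k.1 k.2).2, fun x hx => ?_⟩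
  refine apply_eq_zero_of_forall_inner_eigenspace_eq_zero hT fun σ hσ w hw => ?_
  have expand : w = ∑ l, (b ⟨σ, hσ⟩).repr ⟨w, mem_eigenspace_iff.2 hw⟩ l • (b ⟨σ, hσ⟩ l : H) := by
    simpa using congrArg Subtype.val ((b ⟨σ, hσ⟩).sum_repr ⟨w, mem_eigenspace_iff.2 hw⟩).symm
  rw [expand, sum_inner]
  exact Finset.sum_eq_zero fun l _ => by rw [inner_smul_left, hx ⟨⟨σ, hσ⟩, l⟩, mul_zero]

/-- A singular value decomposition `T = ∑ k, σ k • |e k⟩⟨f k|`, the sum converging weakly. -/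
structure IsSingularSystem (T : H →L[ℂ] H) (e f : SingularIndex T → H) : Prop where
  orthonormal_left : Orthonormal ℂ e
  orthonormal_right : Orthonormal ℂ f
  apply_right : ∀ k, T (f k) = ((k.1 : ℝ) : ℂ) • e k
  hasSum_inner : ∀ x y,
    HasSum (fun k => ((k.1 : ℝ) : ℂ) * (⟪x, e k⟫_ℂ * ⟪f k, y⟫_ℂ)) ⟪x, T y⟫_ℂ

theorem exists_isSingularSystem (hT : IsCompactOperator T) : ∃ e f, IsSingularSystem T e f := by
  obtain ⟨f, hf, hTf, hker⟩ := exists_rightSingularVectors hT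
  have hσ (k : SingularIndex T) : (k.1 : ℝ) ≠ 0 := k.1.2.ne'
  have hTe (k : SingularIndex T) : T (f k) = ((k.1 : ℝ) : ℂ) • ((k.1 : ℝ) : ℂ)⁻¹ • T (f k) :=
    (smul_inv_smul₀ (Complex.ofReal_ne_zero.2 (hσ k)) _).symm
  refine ⟨_, f, orthonormal_inv_smul_apply hf hσ hTf, hf, hTe, fun x y => ?_⟩
  refine (hasSum_inner_apply_mul_inner hf hker x y).congr_fun fun k => ?_
  conv_rhs => rw [hTe k, inner_smul_right, mul_assoc]

end SingularValueDecomposition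

section SchattenPairing

open Filter Matrix Topology
open scoped InnerProductSpace ComplexOrder MatrixOrder

variable {H ι κ : Type*} [NormedAddCommGroup H] [InnerProductSpace ℂ H] [CompleteSpace H]

theorem IsSingularSystem.inner_left_apply_right {T : H →L[ℂ] H} {e f : SingularIndex T → H}
    (h : IsSingularSystem T e f) (k : SingularIndex T) : ⟪e k, T (f k)⟫_ℂ = ((k.1 : ℝ) : ℂ) := by
  rw [h.apply_right, inner_smul_right, inner_self_eq_norm_sq_to_K, h.orthonormal_left.1 k]
  simp only [Complex.coe_algebraMap, Complex.ofReal_one, one_pow, mul_one]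

theorem tendsto_sum_inner_of_isSingularSystem [Fintype κ] {T : κ → H →L[ℂ] H}
    {u v : ∀ k, SingularIndex (T k) → H} (h : ∀ k, IsSingularSystem (T k) (u k) (v k)) (c : κ → ℂ)
    (x y : H) :
    Tendsto (fun A : ∀ k, Finset (SingularIndex (T k)) =>
        ∑ k, c k * ∑ a : A k, ((a.1.1 : ℝ) : ℂ) * (⟪x, u k a⟫_ℂ * ⟪v k a, y⟫_ℂ))
      (Filter.pi fun _ => atTop) (𝓝 ⟪x, (∑ k, c k • T k) y⟫_ℂ) := by
  have expand : ⟪x, (∑ k, c k • T k) y⟫_ℂ = ∑ k, c k * ⟪x, T k y⟫_ℂ := by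
    simp only [_root_.sum_apply, _root_.smul_apply, inner_sum, inner_smul_right]
  rw [expand]
  refine tendsto_finsetSum _ fun k _ => Tendsto.const_mul _ ?_
  have hk := (h k).hasSum_inner x y
  rw [HasSum, SummationFilter.unconditional_filter] at hk
  exact (hk.comp (tendsto_eval_pi _ k)).congr fun A => (Finset.sum_coe_sort (A k) _).symm

theorem tendsto_sum_rpow_schattenNorm {T : H →L[ℂ] H} {p : ℝ} (hp : 0 < p)
    (hT : T ∈ schattenClass H p) :
    Tendsto (fun A : Finset (SingularIndex T) => ∑ k : A, (k.1.1 : ℝ) ^ p) atTop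
      (𝓝 (schattenNorm p T ^ p)) := by
  have hsum := hasSum_schattenNorm hp hT
  rw [HasSum, SummationFilter.unconditional_filter] at hsum
  exact hsum.congr fun A => (Finset.sum_coe_sort A fun k => (k.1 : ℝ) ^ p).symm

theorem sum_rpow_le_schattenNorm_rpow {T : H →L[ℂ] H} {p : ℝ} (hp : 0 < p)
    (hT : T ∈ schattenClass H p) (A : Finset (SingularIndex T)) :
    ∑ k : A, (k.1.1 : ℝ) ^ p ≤ schattenNorm p T ^ p :=
  (Finset.sum_coe_sort A fun k => (k.1 : ℝ) ^ p).trans_le <|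
    sum_le_hasSum A (fun k _ => Real.rpow_nonneg k.1.2.le p) (hasSum_schattenNorm hp hT)

variable [Fintype ι] [Fintype κ] [DecidableEq κ] {Q : Matrix ι κ ℂ} {m p q : ℝ}

theorem norm_sum_inner_le_of_mem_schattenClass (hQ : Qᴴ * Q ≤ 1) (hm : 0 ≤ m)
    (hQm : ∀ i j, ‖Q i j‖ ≤ m) (hpq : p.HolderConjugate q) (hq : 2 ≤ q)
    {Y : κ → H →L[ℂ] H} (hY : ∀ j, Y j ∈ schattenClass H p)
    {β : ι → Type*} [∀ i, Fintype (β i)] {e f : ∀ i, β i → H}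
    (he : ∀ i, Orthonormal ℂ (e i)) (hf : ∀ i, Orthonormal ℂ (f i))
    {z : (Σ i, β i) → ℝ} (hz : ∀ b, 0 < z b) :
    ‖∑ b, (z b : ℂ) * ⟪e b.1 b.2, (∑ j, Q b.1 j • Y j) (f b.1 b.2)⟫_ℂ‖ ≤
      m ^ (1 - 2 / q) * (∑ j, schattenNorm p (Y j) ^ p) ^ (1 / p) *
        (∑ i, (∑ b, z ⟨i, b⟩ ^ q) ^ (p / q)) ^ (1 / p) := by
  choose u v huv using fun j => exists_isSingularSystem (hY j).1
  have hlim := tendsto_finsetSum Finset.univ fun (b : Σ i, β i) _ =>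
    (tendsto_sum_inner_of_isSingularSystem huv (Q b.1) (e b.1 b.2) (f b.1 b.2)).const_mul (z b : ℂ)
  refine le_of_tendsto hlim.norm (Eventually.of_forall fun A => ?_)
  have truncated := norm_dotProduct_pairingMatrix_mulVec_le_mixedNorm hQ hm hQm he hf
    (fun j => (huv j).orthonormal_left.comp (Subtype.val : A j → _) Subtype.val_injective)
    (fun j => (huv j).orthonormal_right.comp (Subtype.val : A j → _) Subtype.val_injective)
    hpq hq hz (y := fun a => a.2.1.1) fun a => a.2.1.1.2
  rw [dotProduct_pairingMatrix_mulVec] at truncated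
  refine truncated.trans ?_
  gcongr
  · exact Real.rpow_nonneg (Finset.sum_nonneg fun i _ => Real.rpow_nonneg
      (Finset.sum_nonneg fun b _ => Real.rpow_nonneg (hz _).le q) _) _
  · exact Finset.sum_nonneg fun a _ => Real.rpow_nonneg a.2.1.1.2.le p
  · exact one_div_nonneg.2 hpq.nonneg
  · exact (Fintype.sum_sigma _).trans_le <|
      Finset.sum_le_sum fun j _ => sum_rpow_le_schattenNorm_rpow hpq.pos (hY j) (A j)

theorem norm_sum_inner_le_of_mem_schattenClass_conj (hQ : Qᴴ * Q ≤ 1) (hm : 0 ≤ m)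
    (hQm : ∀ i j, ‖Q i j‖ ≤ m) (hpq : p.HolderConjugate q) (hq : 2 ≤ q)
    {Z : ι → H →L[ℂ] H} (hZ : ∀ i, Z i ∈ schattenClass H q)
    {α : κ → Type*} [∀ j, Fintype (α j)] {u v : ∀ j, α j → H}
    (hu : ∀ j, Orthonormal ℂ (u j)) (hv : ∀ j, Orthonormal ℂ (v j))
    {y : (Σ j, α j) → ℝ} (hy : ∀ a, 0 < y a) :
    ‖∑ a, (y a : ℂ) * ⟪v a.1 a.2, (∑ i, Q i a.1 • Z i) (u a.1 a.2)⟫_ℂ‖ ≤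
      m ^ (1 - 2 / q) * (∑ a, y a ^ p) ^ (1 / p) *
        (∑ i, schattenNorm q (Z i) ^ p) ^ (1 / p) := by
  choose f e hfe using fun i => exists_isSingularSystem (hZ i).1
  have hlim := tendsto_finsetSum Finset.univ fun (a : Σ j, α j) _ =>
    (tendsto_sum_inner_of_isSingularSystem hfe (fun i => Q i a.1) (v a.1 a.2)
      (u a.1 a.2)).const_mul (y a : ℂ)
  refine le_of_tendsto hlim.norm (Eventually.of_forall fun B => ?_)
  have truncated := norm_dotProduct_pairingMatrix_mulVec_le_mixedNorm hQ hm hQm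
    (fun i => (hfe i).orthonormal_right.comp (Subtype.val : B i → _) Subtype.val_injective)
    (fun i => (hfe i).orthonormal_left.comp (Subtype.val : B i → _) Subtype.val_injective)
    hu hv hpq hq (z := fun b => b.2.1.1) (fun b => b.2.1.1.2) hy
  have hB (i : ι) : 0 ≤ ∑ b : B i, (b.1.1 : ℝ) ^ q :=
    Finset.sum_nonneg fun b _ => Real.rpow_nonneg b.1.1.2.le q
  rw [dotProduct_pairingMatrix_mulVec'] at truncated
  refine truncated.trans ?_
  gcongr with i _
  · exact mul_nonneg (Real.rpow_nonneg hm _) (Real.rpow_nonneg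
      (Finset.sum_nonneg fun a _ => Real.rpow_nonneg (hy a).le p) _)
  · exact Finset.sum_nonneg fun i _ => Real.rpow_nonneg (hB i) _
  · exact one_div_nonneg.2 hpq.nonneg
  · calc (∑ b : B i, (b.1.1 : ℝ) ^ q) ^ (p / q) ≤ (schattenNorm q (Z i) ^ q) ^ (p / q) :=
          Real.rpow_le_rpow (hB i) (sum_rpow_le_schattenNorm_rpow hpq.symm.pos (hZ i) (B i))
            (div_nonneg hpq.nonneg hpq.symm.nonneg)
      _ = schattenNorm q (Z i) ^ p := by
          rw [← Real.rpow_mul (schattenNorm_nonneg q _), mul_div_cancel₀ _ hpq.symm.ne_zero]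

end SchattenPairing

section DualWeights

variable {p q : ℝ}

theorem le_rpow_of_le_mul_rpow {S C : ℝ} (hpq : p.HolderConjugate q) (hS : 0 ≤ S) (hC : 0 ≤ C)
    (h : S ≤ C * S ^ (1 / p)) : S ≤ C ^ q := by
  rcases hS.eq_or_lt with rfl | hS
  · exact Real.rpow_nonneg hC _
  have hexp : 1 / q = 1 - 1 / p := by linear_combination hpq.one_div_add_one_div
  have hroot : S ^ (1 / q) ≤ C := by
    rw [hexp, Real.rpow_sub hS, Real.rpow_one]
    exact (div_le_iff₀ (Real.rpow_pos_of_pos hS _)).2 h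
  calc S = (S ^ (1 / q)) ^ q := by
        rw [← Real.rpow_mul hS.le, one_div_mul_cancel hpq.symm.ne_zero, Real.rpow_one]
    _ ≤ C ^ q := Real.rpow_le_rpow (Real.rpow_nonneg hS.le _) hroot hpq.symm.nonneg

theorem exists_dual_weights {γ : Type*} [Fintype γ] (hpq : p.HolderConjugate q) {σ : γ → ℝ}
    (hσ : ∀ b, 0 < σ b) :
    ∃ z : γ → ℝ, (∀ b, 0 < z b) ∧ ∑ b, z b * σ b = (∑ b, σ b ^ p) ^ (q / p) ∧
      (∑ b, z b ^ q) ^ (p / q) = (∑ b, σ b ^ p) ^ (q / p) := by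
  set G := ∑ b, σ b ^ p with hG
  have hp := hpq.ne_zero
  have hq := hpq.symm.ne_zero
  rcases isEmpty_or_nonempty γ with hγ | hγ
  · refine ⟨σ, hσ, ?_⟩
    simp [hG, Real.zero_rpow, hp, hq]
  have hG₀ : 0 < G := Finset.sum_pos (fun b _ => Real.rpow_pos_of_pos (hσ b) _)
    Finset.univ_nonempty
  refine ⟨fun b => G ^ (q / p - 1) * σ b ^ (p - 1), fun b => mul_pos
    (Real.rpow_pos_of_pos hG₀ _) (Real.rpow_pos_of_pos (hσ b) _), ?_, ?_⟩
  · simp only [mul_assoc, rpow_sub_one_mul_self (hσ _).le hp, ← Finset.mul_sum, ← hG]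
    exact rpow_sub_one_mul_self hG₀.le (div_ne_zero hq hp)
  · have hterm (b : γ) :
        (G ^ (q / p - 1) * σ b ^ (p - 1)) ^ q = G ^ ((q / p - 1) * q) * σ b ^ p := by
      rw [Real.mul_rpow (Real.rpow_nonneg hG₀.le _) (Real.rpow_nonneg (hσ b).le _),
        ← Real.rpow_mul hG₀.le, ← Real.rpow_mul (hσ b).le, hpq.sub_one_mul_conj]
    have hexp : ((q / p - 1) * q + 1) * (p / q) = q / p := by
      field_simp
      linear_combination (q - p) * hpq.mul_eq_add
    simp only [hterm, ← Finset.mul_sum, ← hG]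
    rw [← Real.rpow_add_one hG₀.ne', ← Real.rpow_mul hG₀.le, hexp]

theorem mul_rpow_one_div_rpow {m P : ℝ} (hpq : p.HolderConjugate q) (hm : 0 ≤ m) (hP : 0 ≤ P) :
    (m ^ (1 - 2 / q) * P ^ (1 / p)) ^ q = m ^ (q / p - 1) * P ^ (q / p) := by
  have hq := hpq.symm.ne_zero
  have hexp : (1 - 2 / q) * q = q / p - 1 := by
    rw [hpq.symm.div_conj_eq_sub_one]
    field_simp
    ring
  rw [Real.mul_rpow (Real.rpow_nonneg hm _) (Real.rpow_nonneg hP _), ← Real.rpow_mul hm,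
    ← Real.rpow_mul hP, hexp, one_div_mul_eq_div]

theorem rpow_mul_rpow_le_of_le {m P W : ℝ} (hpq : p.HolderConjugate q) (hm : 0 ≤ m) (hP : 0 ≤ P)
    (hW : 0 ≤ W) (h : P ≤ m ^ (q / p - 1) * W ^ (q / p)) :
    m ^ (p / q - 1) * P ^ (p / q) ≤ W := by
  have hexp : (q / p - 1) * (p / q) = -(p / q - 1) := by
    have hp := hpq.ne_zero
    have hq := hpq.symm.ne_zero
    field_simp
    ring
  have hexp' : q / p * (p / q) = 1 := by
    rw [div_mul_div_cancel₀ hpq.ne_zero, div_self hpq.symm.ne_zero]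
  have hPW : P ^ (p / q) ≤ (m ^ (p / q - 1))⁻¹ * W := by
    calc P ^ (p / q) ≤ (m ^ (q / p - 1) * W ^ (q / p)) ^ (p / q) :=
          Real.rpow_le_rpow hP h (div_nonneg hpq.nonneg hpq.symm.nonneg)
      _ = (m ^ (p / q - 1))⁻¹ * W := by
          rw [Real.mul_rpow (Real.rpow_nonneg hm _) (Real.rpow_nonneg hW _), ← Real.rpow_mul hm,
            ← Real.rpow_mul hW, hexp, hexp', Real.rpow_neg hm, Real.rpow_one]
  calc m ^ (p / q - 1) * P ^ (p / q) ≤ m ^ (p / q - 1) * ((m ^ (p / q - 1))⁻¹ * W) :=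
        mul_le_mul_of_nonneg_left hPW (Real.rpow_nonneg hm _)
    _ ≤ W := by
        rw [← mul_assoc]
        exact mul_le_of_le_one_left hW mul_inv_le_one

end DualWeights

section ContractionInequalities

open Filter Matrix Topology
open scoped InnerProductSpace ComplexOrder MatrixOrder

variable {H ι κ : Type*} [NormedAddCommGroup H] [InnerProductSpace ℂ H] [CompleteSpace H]
  [Fintype ι] [Fintype κ] [DecidableEq κ] {Q : Matrix ι κ ℂ} {m p q : ℝ}

theorem sum_rpow_sum_le_of_inner_eq (hQ : Qᴴ * Q ≤ 1) (hm : 0 ≤ m) (hQm : ∀ i j, ‖Q i j‖ ≤ m)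
    (hpq : p.HolderConjugate q) (hq : 2 ≤ q) {Y : κ → H →L[ℂ] H}
    (hY : ∀ j, Y j ∈ schattenClass H p) {β : ι → Type*} [∀ i, Fintype (β i)]
    {e f : ∀ i, β i → H} (he : ∀ i, Orthonormal ℂ (e i)) (hf : ∀ i, Orthonormal ℂ (f i))
    {σ : ∀ i, β i → ℝ} (hσ : ∀ i b, 0 < σ i b)
    (h : ∀ i b, ⟪e i b, (∑ j, Q i j • Y j) (f i b)⟫_ℂ = σ i b) :
    ∑ i, (∑ b, σ i b ^ p) ^ (q / p) ≤
      m ^ (q / p - 1) * (∑ j, schattenNorm p (Y j) ^ p) ^ (q / p) := by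
  choose z hz hzσ hzq using fun i => exists_dual_weights hpq (hσ i)
  have hP : 0 ≤ ∑ j, schattenNorm p (Y j) ^ p :=
    Finset.sum_nonneg fun j _ => Real.rpow_nonneg (schattenNorm_nonneg p _) _
  have hS : 0 ≤ ∑ i, (∑ b, σ i b ^ p) ^ (q / p) := Finset.sum_nonneg fun i _ =>
    Real.rpow_nonneg (Finset.sum_nonneg fun b _ => Real.rpow_nonneg (hσ i b).le _) _
  have pairing := norm_sum_inner_le_of_mem_schattenClass hQ hm hQm hpq hq hY he hf
    (z := fun b => z b.1 b.2) fun b => hz b.1 b.2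
  have pairing_eq : ∑ b : Σ i, β i, (z b.1 b.2 : ℂ) *
      ⟪e b.1 b.2, (∑ j, Q b.1 j • Y j) (f b.1 b.2)⟫_ℂ =
        ((∑ i, (∑ b, σ i b ^ p) ^ (q / p) : ℝ) : ℂ) := by
    simp only [h, Fintype.sum_sigma, ← hzσ, Complex.ofReal_sum, Complex.ofReal_mul]
  simp only [pairing_eq, hzq, Complex.norm_of_nonneg hS] at pairing
  rw [← mul_rpow_one_div_rpow hpq hm hP]
  exact le_rpow_of_le_mul_rpow hpq hS
    (mul_nonneg (Real.rpow_nonneg hm _) (Real.rpow_nonneg hP _)) pairing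

theorem sum_rpow_le_of_inner_eq (hQ : Qᴴ * Q ≤ 1) (hm : 0 ≤ m) (hQm : ∀ i j, ‖Q i j‖ ≤ m)
    (hpq : p.HolderConjugate q) (hq : 2 ≤ q) {Z : ι → H →L[ℂ] H}
    (hZ : ∀ i, Z i ∈ schattenClass H q) {α : κ → Type*} [∀ j, Fintype (α j)]
    {u v : ∀ j, α j → H} (hu : ∀ j, Orthonormal ℂ (u j)) (hv : ∀ j, Orthonormal ℂ (v j))
    {σ : ∀ j, α j → ℝ} (hσ : ∀ j a, 0 < σ j a)
    (h : ∀ j a, ⟪v j a, (∑ i, Q i j • Z i) (u j a)⟫_ℂ = σ j a) :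
    ∑ j, ∑ a, σ j a ^ q ≤ m ^ (q / p - 1) * (∑ i, schattenNorm q (Z i) ^ p) ^ (q / p) := by
  have hP : 0 ≤ ∑ i, schattenNorm q (Z i) ^ p :=
    Finset.sum_nonneg fun i _ => Real.rpow_nonneg (schattenNorm_nonneg q _) _
  have hS : 0 ≤ ∑ j, ∑ a, σ j a ^ q :=
    Finset.sum_nonneg fun j _ => Finset.sum_nonneg fun a _ => Real.rpow_nonneg (hσ j a).le _
  have pairing := norm_sum_inner_le_of_mem_schattenClass_conj hQ hm hQm hpq hq hZ hu hv
    (y := fun a => σ a.1 a.2 ^ (q - 1)) fun a => Real.rpow_pos_of_pos (hσ a.1 a.2) _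
  have pairing_eq : ∑ a : Σ j, α j, ((σ a.1 a.2 ^ (q - 1) : ℝ) : ℂ) *
      ⟪v a.1 a.2, (∑ i, Q i a.1 • Z i) (u a.1 a.2)⟫_ℂ = ((∑ j, ∑ a, σ j a ^ q : ℝ) : ℂ) := by
    simp only [h, Fintype.sum_sigma, ← Complex.ofReal_mul, ← Complex.ofReal_sum,
      rpow_sub_one_mul_self (hσ _ _).le hpq.symm.ne_zero]
  have weights_rpow (j : κ) (a : α j) : (σ j a ^ (q - 1)) ^ p = σ j a ^ q := by
    rw [← Real.rpow_mul (hσ j a).le, hpq.symm.sub_one_mul_conj]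
  simp only [pairing_eq, weights_rpow, Fintype.sum_sigma, Complex.norm_of_nonneg hS,
    mul_right_comm _ ((∑ j, ∑ a, σ j a ^ q) ^ (1 / p))] at pairing
  rw [← mul_rpow_one_div_rpow hpq hm hP]
  exact le_rpow_of_le_mul_rpow hpq hS
    (mul_nonneg (Real.rpow_nonneg hm _) (Real.rpow_nonneg hP _)) pairing

theorem sum_schattenNorm_rpow_le_of_contraction (hQ : Qᴴ * Q ≤ 1) (hm : 0 ≤ m)
    (hQm : ∀ i j, ‖Q i j‖ ≤ m) (hpq : p.HolderConjugate q) (hq : 2 ≤ q)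
    {X : ι → H →L[ℂ] H} {Y : κ → H →L[ℂ] H} (hX : ∀ i, X i ∈ schattenClass H p)
    (hY : ∀ j, Y j ∈ schattenClass H p) (hXY : ∀ i, X i = ∑ j, Q i j • Y j) :
    ∑ i, schattenNorm p (X i) ^ q ≤
      m ^ (q / p - 1) * (∑ j, schattenNorm p (Y j) ^ p) ^ (q / p) := by
  choose e f hef using fun i => exists_isSingularSystem (hX i).1
  have hlim : Tendsto (fun B : ∀ i, Finset (SingularIndex (X i)) =>
      ∑ i, (∑ b : B i, (b.1.1 : ℝ) ^ p) ^ (q / p)) (Filter.pi fun _ => atTop)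
      (𝓝 (∑ i, (schattenNorm p (X i) ^ p) ^ (q / p))) :=
    tendsto_finsetSum _ fun i _ =>
      ((tendsto_sum_rpow_schattenNorm hpq.pos (hX i)).comp (tendsto_eval_pi _ i)).rpow_const
        (.inr (div_nonneg hpq.symm.nonneg hpq.nonneg))
  simp only [← Real.rpow_mul (schattenNorm_nonneg p _), mul_div_cancel₀ _ hpq.ne_zero] at hlim
  refine le_of_tendsto hlim (Eventually.of_forall fun B => ?_)
  refine sum_rpow_sum_le_of_inner_eq hQ hm hQm hpq hq hY
    (fun i => (hef i).orthonormal_left.comp (Subtype.val : B i → _) Subtype.val_injective)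
    (fun i => (hef i).orthonormal_right.comp (Subtype.val : B i → _) Subtype.val_injective)
    (fun i b => b.1.1.2) fun i b => ?_
  rw [← hXY]
  exact (hef i).inner_left_apply_right b

theorem sum_schattenNorm_rpow_self_le_of_contraction (hQ : Qᴴ * Q ≤ 1) (hm : 0 ≤ m)
    (hQm : ∀ i j, ‖Q i j‖ ≤ m) (hpq : p.HolderConjugate q) (hq : 2 ≤ q)
    {X : ι → H →L[ℂ] H} {Y : κ → H →L[ℂ] H} (hX : ∀ i, X i ∈ schattenClass H q)
    (hY : ∀ j, Y j ∈ schattenClass H q) (hYX : ∀ j, Y j = ∑ i, Q i j • X i) :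
    ∑ j, schattenNorm q (Y j) ^ q ≤
      m ^ (q / p - 1) * (∑ i, schattenNorm q (X i) ^ p) ^ (q / p) := by
  choose v u hvu using fun j => exists_isSingularSystem (hY j).1
  have hlim : Tendsto (fun A : ∀ j, Finset (SingularIndex (Y j)) =>
      ∑ j, ∑ a : A j, (a.1.1 : ℝ) ^ q) (Filter.pi fun _ => atTop)
      (𝓝 (∑ j, schattenNorm q (Y j) ^ q)) :=
    tendsto_finsetSum _ fun j _ =>
      (tendsto_sum_rpow_schattenNorm hpq.symm.pos (hY j)).comp (tendsto_eval_pi _ j)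
  refine le_of_tendsto hlim (Eventually.of_forall fun A => ?_)
  refine sum_rpow_le_of_inner_eq hQ hm hQm hpq hq hX
    (fun j => (hvu j).orthonormal_right.comp (Subtype.val : A j → _) Subtype.val_injective)
    (fun j => (hvu j).orthonormal_left.comp (Subtype.val : A j → _) Subtype.val_injective)
    (fun j a => a.1.1.2) fun j a => ?_
  rw [← hYX]
  exact (hvu j).inner_left_apply_right a

theorem mainTheorem11_general (hQ : Qᴴ * Q ≤ 1) (hm : 0 ≤ m) (hQm : ∀ i j, ‖Q i j‖ ≤ m)
    (hpq : p.HolderConjugate q) {X : ι → H →L[ℂ] H} {Y : κ → H →L[ℂ] H}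
    (hX : ∀ i, X i ∈ schattenClass H p) (hY : ∀ j, Y j ∈ schattenClass H p) :
    (p ≤ 2 → (∀ i, X i = ∑ j, Q i j • Y j) →
      ∑ i, schattenNorm p (X i) ^ q ≤
        m ^ (q / p - 1) * (∑ j, schattenNorm p (Y j) ^ p) ^ (q / p)) ∧
    (2 ≤ p → (∀ j, Y j = ∑ i, Q i j • X i) →
      m ^ (q / p - 1) * (∑ j, schattenNorm p (Y j) ^ p) ^ (q / p) ≤
        ∑ i, schattenNorm p (X i) ^ q) := by
  refine ⟨fun hp hXY => ?_, fun hp hYX => ?_⟩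
  · have hq : 2 ≤ q := by nlinarith [hpq.mul_eq_add, hpq.lt, hpq.symm.lt]
    exact sum_schattenNorm_rpow_le_of_contraction hQ hm hQm hpq hq hX hY hXY
  · have hP : 0 ≤ ∑ j, schattenNorm p (Y j) ^ p :=
      Finset.sum_nonneg fun j _ => Real.rpow_nonneg (schattenNorm_nonneg p _) _
    have hW : 0 ≤ ∑ i, schattenNorm p (X i) ^ q :=
      Finset.sum_nonneg fun i _ => Real.rpow_nonneg (schattenNorm_nonneg p _) _
    exact rpow_mul_rpow_le_of_le hpq.symm hm hP hW
      (sum_schattenNorm_rpow_self_le_of_contraction hQ hm hQm hpq.symm hp hX hY hYX)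

end ContractionInequalities

section Suborthogonal

open Matrix
open scoped ComplexOrder MatrixOrder

variable {s t : ℕ} {Q : Matrix (Fin s) (Fin t) ℝ}

theorem IsSuborthogonal.conjTranspose_map_ofReal_mul_self_le_one (hQ : IsSuborthogonal Q) :
    (Q.map Complex.ofReal)ᴴ * Q.map Complex.ofReal ≤ 1 := by
  have hstar : (Q.map Complex.ofReal)ᴴ = Qᵀ.map Complex.ofReal := by
    ext j i
    exact Complex.conj_ofReal (Q i j)
  have hmul := congrArg (fun A : Matrix (Fin t) (Fin t) ℝ => A.map Complex.ofRealHom) hQ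
  rw [Matrix.map_mul, Matrix.map_one _ (map_zero _) (map_one _)] at hmul
  rw [hstar]
  exact hmul.le

theorem IsSuborthogonal.eq_sum_smul {E : Type*} [AddCommGroup E] [Module ℂ E]
    (hQ : IsSuborthogonal Q) {X : Fin s → E} {Y : Fin t → E}
    (hXY : ∀ i, X i = ∑ j, ((Q i j : ℝ) : ℂ) • Y j) (j : Fin t) :
    Y j = ∑ i, ((Q i j : ℝ) : ℂ) • X i := by
  have gram (k : Fin t) : ∑ i, Q i j * Q i k = if j = k then 1 else 0 := by
    simpa only [mul_apply, transpose_apply, one_apply] using congrFun (congrFun hQ j) k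
  simp only [hXY, Finset.smul_sum, smul_smul, ← Complex.ofReal_mul]
  rw [Finset.sum_comm]
  simp only [← Finset.sum_smul, ← Complex.ofReal_sum, gram, apply_ite Complex.ofReal,
    Complex.ofReal_one, Complex.ofReal_zero, ite_smul, one_smul, zero_smul, Finset.sum_ite_eq,
    Finset.mem_univ, if_true]

theorem maxAbsEntry_nonneg (Q : Matrix (Fin s) (Fin t) ℝ) : 0 ≤ maxAbsEntry Q :=
  Real.iSup_nonneg fun _ => abs_nonneg _

theorem abs_le_maxAbsEntry (Q : Matrix (Fin s) (Fin t) ℝ) (i : Fin s) (j : Fin t) :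
    |Q i j| ≤ maxAbsEntry Q :=
  le_ciSup (Set.finite_range fun ij : Fin s × Fin t => |Q ij.1 ij.2|).bddAbove (i, j)

end Suborthogonal

theorem mainTheorem11 {H : Type*} [NormedAddCommGroup H] [InnerProductSpace ℂ H]
    [CompleteSpace H] {s t : ℕ} (Q : Matrix (Fin s) (Fin t) ℝ) (hQ : IsSuborthogonal Q)
    (p q : ℝ) (hpq : p.HolderConjugate q)
    (X : Fin s → H →L[ℂ] H) (Y : Fin t → H →L[ℂ] H)
    (hX : ∀ i, X i ∈ schattenClass H p) (hY : ∀ j, Y j ∈ schattenClass H p)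
    (hXY : ∀ i, X i = ∑ j, ((Q i j : ℝ) : ℂ) • Y j) :
    (p ≤ 2 →
      ∑ i, schattenNorm p (X i) ^ q ≤
        maxAbsEntry Q ^ (q / p - 1) * (∑ j, schattenNorm p (Y j) ^ p) ^ (q / p)) ∧
    (2 ≤ p →
      maxAbsEntry Q ^ (q / p - 1) * (∑ j, schattenNorm p (Y j) ^ p) ^ (q / p) ≤
        ∑ i, schattenNorm p (X i) ^ q) := by
  have general := mainTheorem11_general hQ.conjTranspose_map_ofReal_mul_self_le_one
    (maxAbsEntry_nonneg Q) (fun i j => (Complex.norm_real _).trans_le (abs_le_maxAbsEntry Q i j))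
    hpq hX hY
  exact ⟨fun hp => general.1 hp hXY, fun hp => general.2 hp (hQ.eq_sum_smul hXY)⟩
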